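/- Let $G$ be an $n$-dimensional real Lie group (smooth, Hausdorff, second countable) with identity $e$, let $dg$ be a right-invariant Haar measure on $G$, and let $L^2(G)$ be the corresponding real $L^2$ space. Let $X_1,\dots,X_n$ be a basis of the Lie algebra of $G$, regarded as left-invariant vector fields, so that $X_if(g)=\frac{d}{du}f(g\exp(uX_i))|_{u=0}$. Indices are raised and lowered freely ($X^i=X_i$, $x^i=x_i$, $b^i=b_i$, $a^{ij}=a_{ij}$) and repeated indices are summed from $1$ to $n$. Let $U$ be a relatively compact open neighbourhood of $e$ and let $x_1,\dots,x_n\in C_c^\infty(G)$ be canonical coordinates on $U$, i.e. $\tau=\exp(x^i(\tau)X_i)$ for $\tau\in U$ and $x_i(e)=0$, with $x_i(\tau^{-1})=-x_i(\tau)$ for all $\tau\in G$. A Lévy measure on $G$ is a Borel measure $\rho$ with $\rho(\{e\})=0$, $\rho(V^c)<\infty$ for every neighbourhood $V$ of $e$, and $\int_G\big(\sum_i x_i(\tau)^2\wedge 1\big)\rho(d\tau)<\infty$. For functions $b^i,a^{ij}:G\to\mathbb R$ and Borel measures $\nu(g,\cdot)$, $g\in G$, on $G$, define for $f\in C_c^\infty(G)$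 $$\mathcal Lf(g)=b^i(g)X_if(g)+a^{ij}(g)X_iX_jf(g)+\int_G\big[f(\tau)-f(g)-x^i(g^{-1}\tau)X_if(g)\big]\nu(g,d\tau).$$ Write $\nu(g,g\,d\tau)$ for the measure $A\mapsto\nu(g,gA)$. Assume: - $b^i$, $a^{ij}$ are bounded and measurable, and $(a^{ij}(g))$ is symmetric and non-negative definite for each $g$; - $\nu(g,\{g\})=0$ for all $g$, $g\mapsto\nu(g,gE)$ is measurable for each Borel set $E$, and $\sup_{g}\int_G\big(\sum_i x_i(\tau)^2\wedge 1\big)\nu(g,g\,d\tau)<\infty$; - there is a Lévy measure $\rho$ on $G$ such that for each $g$, $\nu(g,g\,d\tau)=\lambda(g,\tau)\rho(d\tau)$, with $\lambda:G\times G\to[0,\infty)$ jointly measurable; - $\sup_{\tau\in U^c}\sup_{g\in G}\lambda(g,\tau)<\infty$, and there is $g'\in G$ with $\lambda(g',\tau)=\sup_{g\in G}\lambda(g,\tau)$ for all $\tau\in U$; - $b_i\in C^1(G)$, $a_{jk}\in C^2(G)$, and $X_lb_i$, $X_la_{jk}$, $X_pX_qa_{jk}$ are bounded, for all indices; - $g\mapsto\lambda(g,\tau)$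 is $C^1$ for $\rho$-almost all $\tau$; - $\int_G\int_G|x^i(\tau)X_i\lambda(g,\tau)|\,\rho(d\tau)\,dg<\infty$, and $c(g):=\int_Gx^i(\tau)X_i\lambda(g,\tau)\,\rho(d\tau)$ (derivatives taken in $g$) is a bounded measurable function on $G$; - $\lambda(g,\tau)>0$ except on a set of $(g,\tau)$ that is null for the measure $\nu(g,g\,d\tau)\,dg$; - there are $K>0$ and bounded measurable functions $\alpha_1,\dots,\alpha_n$ on $G\times U$ such that $|\lambda(g\tau^{-1},\tau)-\lambda(g,\tau)|\le K|x^i(\tau)\alpha_i(g,\tau)|$ for all $g\in G$, $\tau\in U$. Let $R_\rho f(g)=\int_Gf(g\tau^{-1})\big(\lambda(g\tau^{-1},\tau)-\lambda(g,\tau)\big)\rho(d\tau)$. Suppose that for all $g\in G$: 1. $b^i(g)=X_j(a^{ij})(g)$ for $1\le i\le n$; 2. $R_\rho f(g)=-c(g)f(g)$ for all $f\in C_c^\infty(G)$; 3. $\nu(g,gA)=\nu(g,gA^{-1})$ for all Borel sets $A\subseteq G$. Then $\mathcal L$, with domain $C_c^\infty(G)$, is a symmetric operator in $L^2(G)$: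 $\mathcal Lf\in L^2(G)$ and $\langle\mathcal Lf,h\rangle=\langle f,\mathcal Lh\rangle$ for all $f,h\in C_c^\infty(G)$. Moreover, for all $f\in C_c^\infty(G)$ and $g\in G$, $$\mathcal Lf(g)=X^i\big(a_{ij}X^jf\big)(g)+\frac12\int_G\big(f(g\tau)-2f(g)+f(g\tau^{-1})\big)\,\nu(g,g\,d\tau),$$ where this integral and the one defining $\mathcal Lf(g)$ converge absolutely. -/

import Mathlib

open MeasureTheory Set Topology
open scoped Manifold ContDiff ENNReal

noncomputable section

namespace CourregeHunt

section LieGroup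

variable {n : ℕ} {G : Type*} [TopologicalSpace G] [ChartedSpace (EuclideanSpace ℝ (Fin n)) G]
  [Group G]

/-- The derivative `v f` of a real function on the Lie group `G` along the left invariant vector
field whose value at the identity is `v`. -/
def lieDeriv (v : GroupLieAlgebra (𝓡 n) G) (f : G → ℝ) (g : G) : ℝ :=
  mfderiv (𝓡 n) 𝓘(ℝ, ℝ) f g (mulInvariantVectorField v g)

/-- `f ∈ C_c^∞(G)`. -/
def IsTestFunction (n : ℕ) {G : Type*} [TopologicalSpace G]
    [ChartedSpace (EuclideanSpace ℝ (Fin n)) G] (f : G → ℝ) : Prop :=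
  ContMDiff (𝓡 n) 𝓘(ℝ, ℝ) ∞ f ∧ HasCompactSupport f

/-- `f` is a bounded function. -/
def IsBdd {α : Type*} (f : α → ℝ) : Prop := ∃ C : ℝ, ∀ p, |f p| ≤ C

/-- `τ = exp v`: the integral curve through the identity of the left invariant vector field
determined by `v` is at `τ` at time one. -/
def IsExp (v : GroupLieAlgebra (𝓡 n) G) (τ : G) : Prop :=
  ∃ γ : ℝ → G, γ 0 = 1 ∧ IsMIntegralCurve (I := 𝓡 n) γ (mulInvariantVectorField v) ∧ γ 1 = τ

/-- `x₁, …, xₙ ∈ C_c^∞(G)` are canonical coordinates (with respect to the basis `X` of the Lie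
algebra) on the relatively compact open neighbourhood `U` of the identity, extended to `G` in such
a way that `xᵢ(τ⁻¹) = -xᵢ(τ)` for all `τ ∈ G`. -/
structure IsCanonicalCoord (X : Module.Basis (Fin n) ℝ (GroupLieAlgebra (𝓡 n) G))
    (U : Set G) (x : Fin n → G → ℝ) : Prop where
  isOpen : IsOpen U
  one_mem : (1 : G) ∈ U
  isCompact_closure : IsCompact (closure U)
  test : ∀ i, IsTestFunction n (x i)
  map_one : ∀ i, x i 1 = 0
  exp_coord : ∀ τ ∈ U, IsExp (∑ i, x i τ • X i) τ
  odd : ∀ i τ, x i τ⁻¹ = -x i τ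

variable [MeasurableSpace G]

/-- `ρ` is a Lévy measure on `G`: it does not charge the identity, it has finite mass off each
neighbourhood of the identity, and `∫ (∑ xᵢ² ∧ 1) dρ < ∞`. -/
structure IsLevyMeasure (x : Fin n → G → ℝ) (ρ : Measure G) : Prop where
  singleton_one : ρ {1} = 0
  finite_off : ∀ V ∈ 𝓝 (1 : G), ρ Vᶜ < ⊤
  lintegral_lt : ∫⁻ τ, ENNReal.ofReal (min (∑ i, x i τ ^ 2) 1) ∂ρ < ⊤

/-- The measure `A ↦ ν(g, gA)`, written `ν(g, g dτ)` under an integral. -/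
def transl (ν : G → Measure G) (g : G) : Measure G := (ν g).map (fun τ => g⁻¹ * τ)

/-- The Courrège–Hunt operator with characteristics `(b, a, ν)`. -/
def op (X : Module.Basis (Fin n) ℝ (GroupLieAlgebra (𝓡 n) G)) (x : Fin n → G → ℝ)
    (b : Fin n → G → ℝ) (a : Fin n → Fin n → G → ℝ) (ν : G → Measure G)
    (f : G → ℝ) (g : G) : ℝ :=
  ∑ i, b i g * lieDeriv (X i) f g
    + ∑ i, ∑ j, a i j g * lieDeriv (X i) (lieDeriv (X j) f) g
    + ∫ τ, (f τ - f g - ∑ i, x i (g⁻¹ * τ) * lieDeriv (X i) f g) ∂(ν g)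

/-- Standing assumptions on the characteristics `(b, a, ν)` of a Courrège–Hunt operator, where `lam`
is the density `λ(g, τ)` of `ν(g, g dτ)` with respect to the Lévy measure `ρ`. -/
structure IsCharacteristics (U : Set G) (x : Fin n → G → ℝ)
    (b : Fin n → G → ℝ) (a : Fin n → Fin n → G → ℝ) (ν : G → Measure G)
    (ρ : Measure G) (lam : G → G → ℝ) : Prop where
  b_measurable : ∀ i, Measurable (b i)
  b_bdd : ∀ i, IsBdd (b i)
  a_measurable : ∀ i j, Measurable (a i j)
  a_bdd : ∀ i j, IsBdd (a i j)
  a_posSemidef : ∀ g, (Matrix.of fun i j => a i j g).PosSemidef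
  ν_singleton : ∀ g, ν g {g} = 0
  ν_measurable : ∀ E, MeasurableSet E → Measurable fun g => transl ν g E
  ν_levy : ⨆ g, ∫⁻ τ, ENNReal.ofReal (min (∑ i, x i τ ^ 2) 1) ∂(transl ν g) < ⊤
  ρ_levy : IsLevyMeasure x ρ
  lam_measurable : Measurable (Function.uncurry lam)
  lam_nonneg : ∀ g τ, 0 ≤ lam g τ
  density : ∀ g, transl ν g = ρ.withDensity fun τ => ENNReal.ofReal (lam g τ)
  lam_bdd_off : ∃ M : ℝ, ∀ τ ∉ U, ∀ g, lam g τ ≤ M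
  lam_sup_attained : ∃ g' : G, ∀ τ ∈ U, ∀ g, lam g τ ≤ lam g' τ

/-- The integrand `xⁱ(τ) Xᵢλ(g, τ)`, the derivatives being taken in `g`. -/
def coordDeriv (X : Module.Basis (Fin n) ℝ (GroupLieAlgebra (𝓡 n) G)) (x : Fin n → G → ℝ)
    (lam : G → G → ℝ) (g τ : G) : ℝ :=
  ∑ i, x i τ * lieDeriv (X i) (fun g' => lam g' τ) g

/-- The function `c(g) = ∫ xⁱ(τ) Xᵢλ(g, τ) ρ(dτ)`. -/
def cFun (X : Module.Basis (Fin n) ℝ (GroupLieAlgebra (𝓡 n) G)) (x : Fin n → G → ℝ)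
    (ρ : Measure G) (lam : G → G → ℝ) (g : G) : ℝ :=
  ∫ τ, coordDeriv X x lam g τ ∂ρ

/-- The operator `R_ρ f(g) = ∫ f(gτ⁻¹) (λ(gτ⁻¹, τ) - λ(g, τ)) ρ(dτ)`. -/
def Rop (ρ : Measure G) (lam : G → G → ℝ) (f : G → ℝ) (g : G) : ℝ :=
  ∫ τ, f (g * τ⁻¹) * (lam (g * τ⁻¹) τ - lam g τ) ∂ρ

/-- Additional standing regularity assumptions, under which the adjoint is studied. -/
structure IsRegular (X : Module.Basis (Fin n) ℝ (GroupLieAlgebra (𝓡 n) G))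
    (μ : Measure G) (U : Set G) (x : Fin n → G → ℝ)
    (b : Fin n → G → ℝ) (a : Fin n → Fin n → G → ℝ) (ν : G → Measure G)
    (ρ : Measure G) (lam : G → G → ℝ) : Prop where
  b_contMDiff : ∀ i, ContMDiff (𝓡 n) 𝓘(ℝ, ℝ) 1 (b i)
  a_contMDiff : ∀ j k, ContMDiff (𝓡 n) 𝓘(ℝ, ℝ) 2 (a j k)
  lieDeriv_b_bdd : ∀ l i, IsBdd (lieDeriv (X l) (b i))
  lieDeriv_a_bdd : ∀ l j k, IsBdd (lieDeriv (X l) (a j k))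
  lieDeriv_lieDeriv_a_bdd : ∀ p q j k, IsBdd (lieDeriv (X p) (lieDeriv (X q) (a j k)))
  lam_contMDiff : ∀ᵐ τ ∂ρ, ContMDiff (𝓡 n) 𝓘(ℝ, ℝ) 1 (fun g => lam g τ)
  coordDeriv_integrable : ∫⁻ g, ∫⁻ τ, ENNReal.ofReal |coordDeriv X x lam g τ| ∂ρ ∂μ < ⊤
  c_measurable : Measurable (cFun X x ρ lam)
  c_bdd : IsBdd (cFun X x ρ lam)
  lam_pos : ∀ᵐ g ∂μ, ∀ᵐ τ ∂(transl ν g), 0 < lam g τ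
  lam_modulus : ∃ K : ℝ, 0 < K ∧ ∃ α : Fin n → G × U → ℝ,
    (∀ i, Measurable (α i)) ∧ (∀ i, IsBdd (α i)) ∧
    ∀ (g : G) (τ : U), |lam (g * (τ : G)⁻¹) τ - lam g τ| ≤ K * |∑ i, x i τ * α i (g, τ)|

/-- `L`, with domain `C_c^∞(G)`, is a symmetric operator in the real Hilbert space `L²(G, μ)`. -/
def IsSymmetricOp (n : ℕ) {G : Type*} [TopologicalSpace G] [MeasurableSpace G]
    [ChartedSpace (EuclideanSpace ℝ (Fin n)) G] (μ : Measure G)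
    (L : (G → ℝ) → G → ℝ) : Prop :=
  (∀ f, IsTestFunction n f → MemLp (L f) 2 μ) ∧
  ∀ f h, IsTestFunction n f → IsTestFunction n h →
    ∫ g, L f g * h g ∂μ = ∫ g, f g * L h g ∂μ

end LieGroup

end CourregeHunt

end

set_option linter.unusedSectionVars false

namespace CourregeHunt

/-! ### Calculus of derivatives along left invariant vector fields -/

section LieDerivative

variable {n : ℕ} {G : Type*} [TopologicalSpace G] [ChartedSpace (EuclideanSpace ℝ (Fin n)) G]
  [Group G]

/-! Because the coordinates are odd and `ν(g, g dτ)` is inversion invariant, averaging the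
compensated increment over `τ` and `τ⁻¹` cancels the compensator and leaves half the second
difference (`IsCharacteristics.integral_compIncr`). With `b` the divergence of `a`, the differential
part takes divergence form, which gives the formula for the operator.

The differential part is symmetric by integration by parts: left invariant fields generate right
translations, which preserve `μ` (`integral_lieDeriv_eq_zero`).

For the jump part, fix `g` and apply condition 2 to `y ↦ ψ(y⁻¹g)` with `ψ` supported away from the
identity. The right side is a multiple of `ψ(1) = 0`, so `∫ ψ(τ) (λ(gτ⁻¹, τ) - λ(g, τ)) ρ(dτ) = 0`
for all such `ψ`. Hence `λ(gτ⁻¹, τ) = λ(g, τ)` for `ρ`-almost all `τ`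
(`IsCharacteristics.ae_lam_mul_inv_eq`). By this balance and right invariance, the translation `g ↦
gτ⁻¹` exchanges the forward term for `(f, h)` with the backward term for `(h, f)`; Fubini then gives
symmetry.

Finally `𝓛f` is bounded, and off a compact set only jumps outside `U` contribute, which bounds it by
an average of translates of `|f|` over a finite measure. So `𝓛f` lies in `L¹ ∩ L^∞`, hence in `L²`.
-/

theorem lieDeriv_sum_smul {ι : Type*} (s : Finset ι) (c : ι → ℝ)
    (X : ι → GroupLieAlgebra (𝓡 n) G) (f : G → ℝ) (g : G) :
    lieDeriv (∑ i ∈ s, c i • X i) f g = ∑ i ∈ s, c i * lieDeriv (X i) f g := by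
  -- All tangent spaces unfold to the model space, so linearity in `v` is read off one fixed
  -- continuous linear map.
  have h : ∀ v : GroupLieAlgebra (𝓡 n) G, lieDeriv v f g =
      ((mfderiv (𝓡 n) 𝓘(ℝ, ℝ) f g : EuclideanSpace ℝ (Fin n) →L[ℝ] ℝ).comp
        (mfderiv (𝓡 n) (𝓡 n) (g * ·) (1 : G) :
          EuclideanSpace ℝ (Fin n) →L[ℝ] EuclideanSpace ℝ (Fin n)))
        (v : EuclideanSpace ℝ (Fin n)) := fun v => rfl
  simp only [h]
  exact (map_sum _ _ _).trans (Finset.sum_congr rfl fun i _ => map_smul _ _ _)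

theorem lieDeriv_const (v : GroupLieAlgebra (𝓡 n) G) (c : ℝ) (g : G) :
    lieDeriv v (fun _ => c) g = 0 := by
  simp only [lieDeriv, mfderiv_const]
  rfl

theorem lieDeriv_congr {v : GroupLieAlgebra (𝓡 n) G} {f h : G → ℝ} {g : G}
    (hfh : f =ᶠ[𝓝 g] h) : lieDeriv v f g = lieDeriv v h g := by
  exact congrArg (fun L : EuclideanSpace ℝ (Fin n) →L[ℝ] ℝ =>
    L (mulInvariantVectorField v g : EuclideanSpace ℝ (Fin n))) hfh.mfderiv_eq

theorem tsupport_lieDeriv_subset (v : GroupLieAlgebra (𝓡 n) G) (f : G → ℝ) :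
    tsupport (lieDeriv v f) ⊆ tsupport f := by
  refine closure_minimal (fun g hg => ?_) isClosed_closure
  by_contra h
  exact hg ((lieDeriv_congr (notMem_tsupport_iff_eventuallyEq.mp h)).trans
    (lieDeriv_const v 0 g))

theorem _root_.HasCompactSupport.lieDeriv {f : G → ℝ} (hf : HasCompactSupport f)
    (v : GroupLieAlgebra (𝓡 n) G) : HasCompactSupport (lieDeriv v f) :=
  hf.of_isClosed_subset isClosed_closure (tsupport_lieDeriv_subset v f)

theorem lieDeriv_mul (v : GroupLieAlgebra (𝓡 n) G) {f h : G → ℝ} {g : G}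
    (hf : MDifferentiableAt (𝓡 n) 𝓘(ℝ, ℝ) f g) (hh : MDifferentiableAt (𝓡 n) 𝓘(ℝ, ℝ) h g) :
    lieDeriv v (fun y => f y * h y) g = lieDeriv v f g * h g + f g * lieDeriv v h g := by
  have h1 := congrArg (fun L : EuclideanSpace ℝ (Fin n) →L[ℝ] ℝ =>
    L (mulInvariantVectorField v g : EuclideanSpace ℝ (Fin n)))
    (hf.hasMFDerivAt.mul hh.hasMFDerivAt).mfderiv
  have h2 : lieDeriv v (fun y => f y * h y) g = f g * lieDeriv v h g + h g * lieDeriv v f g := h1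
  rw [h2]
  ring

theorem lieDeriv_sum (v : GroupLieAlgebra (𝓡 n) G) {ι : Type} (s : Finset ι) {f : ι → G → ℝ}
    {g : G} (hf : ∀ i ∈ s, MDifferentiableAt (𝓡 n) 𝓘(ℝ, ℝ) (f i) g) :
    lieDeriv v (fun y => ∑ i ∈ s, f i y) g = ∑ i ∈ s, lieDeriv v (f i) g := by
  classical
  induction s using Finset.induction_on with
  | empty => simpa using lieDeriv_const v 0 g
  | insert i s hi ih =>
    simp only [Finset.mem_insert, forall_eq_or_imp] at hf
    have hs : MDifferentiableAt (𝓡 n) 𝓘(ℝ, ℝ) (fun y => ∑ i ∈ s, f i y) g := by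
      have := MDifferentiableAt.sum (t := s) hf.2
      rwa [show (∑ i ∈ s, f i) = fun y => ∑ i ∈ s, f i y from by ext; simp] at this
    simp only [Finset.sum_insert hi]
    rw [← ih hf.2]
    exact congrArg (fun L : EuclideanSpace ℝ (Fin n) →L[ℝ] ℝ =>
      L (mulInvariantVectorField v g : EuclideanSpace ℝ (Fin n)))
      (hf.1.hasMFDerivAt.add hs.hasMFDerivAt).mfderiv

variable [LieGroup (𝓡 n) ∞ G]

theorem contMDiff_mulInvariantVectorField_two (v : GroupLieAlgebra (𝓡 n) G) :
    ContMDiff (𝓡 n) (𝓡 n).tangent 2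
      (fun g : G => (mulInvariantVectorField v g : TangentBundle (𝓡 n) G)) := by
  have h3 : LieGroup (𝓡 n) (minSmoothness ℝ 3) G := by
    rw [minSmoothness_of_isRCLikeNormedField]
    exact LieGroup.of_le (n := ∞) (by norm_cast)
  exact (contMDiff_mulInvariantVectorField (I := 𝓡 n) (G := G) v).of_le
    (by simp [minSmoothness_of_isRCLikeNormedField])

/-- The derivative is the fibre component of the tangent map of `f` composed with the vector field;
the cap `m ≤ 2` is the smoothness recorded for the field. -/
theorem _root_.ContMDiff.lieDeriv {m : WithTop ℕ∞} {f : G → ℝ}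
    (hf : ContMDiff (𝓡 n) 𝓘(ℝ, ℝ) (m + 1) f) (hm : m ≤ 2) (v : GroupLieAlgebra (𝓡 n) G) :
    ContMDiff (𝓡 n) 𝓘(ℝ, ℝ) m (lieDeriv v f) := by
  have hV := contMDiff_mulInvariantVectorField_two v
  have hT := hf.contMDiff_tangentMap le_rfl
  exact (contMDiff_snd_tangentBundle_modelSpace ℝ 𝓘(ℝ, ℝ)).comp (hT.comp (hV.of_le hm))

/-- The chain rule for left translation by `g * h` as a composition. -/
theorem mulInvariantVectorField_mul (v : GroupLieAlgebra (𝓡 n) G) (g h : G) :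
    mulInvariantVectorField v (g * h) =
      mfderiv (𝓡 n) (𝓡 n) (g * ·) h (mulInvariantVectorField v h) := by
  have hd : ∀ a y : G, MDifferentiableAt (𝓡 n) (𝓡 n) (a * ·) y := fun a y =>
    (contMDiff_mul_left (I := 𝓡 n) (n := ∞) (a := a)).contMDiffAt.mdifferentiableAt (by simp)
  have h2 : (fun y => g * h * y) = (fun y => g * y) ∘ (fun y => h * y) := by
    ext y; simp [mul_assoc]
  -- The chain rule produces the base point `h * 1`. It is replaced by `h` at a fixed type, since
  -- the tangent spaces depend on the point.
  have h3 : ∀ y, y = h → (mfderiv (𝓡 n) (𝓡 n) (g * ·) y :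
      EuclideanSpace ℝ (Fin n) →L[ℝ] EuclideanSpace ℝ (Fin n)) =
      mfderiv (𝓡 n) (𝓡 n) (g * ·) h := by rintro y rfl; rfl
  have h4 : (mfderiv (𝓡 n) (𝓡 n) (fun y => g * h * y) (1 : G) :
      EuclideanSpace ℝ (Fin n) →L[ℝ] EuclideanSpace ℝ (Fin n)) =
      ((mfderiv (𝓡 n) (𝓡 n) (g * ·) h :
        EuclideanSpace ℝ (Fin n) →L[ℝ] EuclideanSpace ℝ (Fin n)).comp
      (mfderiv (𝓡 n) (𝓡 n) (h * ·) (1 : G) :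
        EuclideanSpace ℝ (Fin n) →L[ℝ] EuclideanSpace ℝ (Fin n))) := by
    rw [h2, ← h3 (h * 1) (mul_one h)]
    exact mfderiv_comp (I' := 𝓡 n) _ (hd _ _) (hd _ _)
  exact congrArg (fun L : EuclideanSpace ℝ (Fin n) →L[ℝ] EuclideanSpace ℝ (Fin n) =>
    L (v : EuclideanSpace ℝ (Fin n))) h4

/-- The derivative of a function along left translates of integral curves. -/
theorem hasDerivAt_comp_mul_of_hasMFDerivAt {v : GroupLieAlgebra (𝓡 n) G} {γ : ℝ → G} {t : ℝ}
    (hγ : HasMFDerivAt 𝓘(ℝ, ℝ) (𝓡 n) γ t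
      ((1 : ℝ →L[ℝ] ℝ).smulRight (mulInvariantVectorField v (γ t))))
    {f : G → ℝ} (hf : ContMDiff (𝓡 n) 𝓘(ℝ, ℝ) 1 f) (g : G) :
    HasDerivAt (fun s => f (g * γ s)) (lieDeriv v f (g * γ t)) t := by
  have hd : MDifferentiableAt (𝓡 n) (𝓡 n) (g * ·) (γ t) :=
    (contMDiff_mul_left (I := 𝓡 n) (n := ∞) (a := g)).contMDiffAt.mdifferentiableAt (by simp)
  have h1 := ((hf.mdifferentiableAt (x := g * γ t) one_ne_zero).hasMFDerivAt.comp t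
    (hd.hasMFDerivAt.comp t hγ))
  have h2 : HasFDerivAt (fun s => f (g * γ s)) ((1 : ℝ →L[ℝ] ℝ).smulRight
      (lieDeriv v f (g * γ t))) t := by
    refine HasFDerivAt.congr_fderiv (f := fun s => f (g * γ s)) h1.hasFDerivAt ?_
    refine ContinuousLinearMap.ext_ring ?_
    refine Eq.trans ?_ (one_smul ℝ (lieDeriv v f (g * γ t))).symm
    simp only [lieDeriv, mulInvariantVectorField_mul v g (γ t)]
    exact (congrArg (fun w : EuclideanSpace ℝ (Fin n) =>
      (mfderiv (𝓡 n) 𝓘(ℝ, ℝ) f (g * γ t) : EuclideanSpace ℝ (Fin n) →L[ℝ] ℝ)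
        ((mfderiv (𝓡 n) (𝓡 n) (g * ·) (γ t) :
          EuclideanSpace ℝ (Fin n) →L[ℝ] EuclideanSpace ℝ (Fin n)) w))
      (one_smul ℝ (mulInvariantVectorField v (γ t) : EuclideanSpace ℝ (Fin n))))
  simpa using h2.hasDerivAt

end LieDerivative

end CourregeHunt

namespace CourregeHunt

/-! ### Taylor estimate and integration by parts -/

section Integration

open scoped Pointwise

variable {n : ℕ} {G : Type*} [TopologicalSpace G] [ChartedSpace (EuclideanSpace ℝ (Fin n)) G]
  [Group G] [LieGroup (𝓡 n) ∞ G]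

/-- Second order Taylor estimate along a one-parameter subgroup. -/
theorem IsExp.abs_sub_sub_lieDeriv_le {v : GroupLieAlgebra (𝓡 n) G} {τ : G} (hτ : IsExp v τ)
    {f : G → ℝ} (hf : ContMDiff (𝓡 n) 𝓘(ℝ, ℝ) 2 f) {C : ℝ}
    (hC : ∀ y, |lieDeriv v (lieDeriv v f) y| ≤ C) (g : G) :
    |f (g * τ) - f g - lieDeriv v f g| ≤ C := by
  obtain ⟨γ, h0, hγ, rfl⟩ := hτ
  have hf' : ContMDiff (𝓡 n) 𝓘(ℝ, ℝ) 1 (lieDeriv v f) :=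
    ContMDiff.lieDeriv (m := 1) (by simpa [one_add_one_eq_two] using hf) one_le_two v
  have d1 := fun t => hasDerivAt_comp_mul_of_hasMFDerivAt (hγ t) (hf.of_le one_le_two) g
  have d2 := fun t => hasDerivAt_comp_mul_of_hasMFDerivAt (hγ t) hf' g
  have hC0 : 0 ≤ C := (abs_nonneg _).trans (hC 1)
  have b1 : ∀ t ∈ Icc (0 : ℝ) 1, |lieDeriv v f (g * γ t) - lieDeriv v f g| ≤ C := by
    intro t ht
    have := norm_image_sub_le_of_norm_deriv_le_segment' (f := fun t => lieDeriv v f (g * γ t))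
      (a := 0) (b := 1) (C := C) (fun s _ => (d2 s).hasDerivWithinAt) (fun s _ => hC _) t ht
    simp only [h0, mul_one, Real.norm_eq_abs, sub_zero] at this
    exact this.trans (mul_le_of_le_one_right hC0 ht.2)
  -- Subtracting the linear term leaves a function whose derivative is bounded by `b1`; the constant
  -- `C` in place of `C / 2` suffices.
  have := norm_image_sub_le_of_norm_deriv_le_segment_01'
    (f := fun t => f (g * γ t) - t * lieDeriv v f g) (C := C)
    (fun s _ => ((d1 s).sub ((hasDerivAt_id s).mul_const _)).hasDerivWithinAt)
    (fun s hs => by simpa using b1 s (Ico_subset_Icc_self hs))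
  simp only [h0, mul_one, Real.norm_eq_abs, one_mul, zero_mul, sub_zero] at this
  rwa [sub_right_comm] at this

variable [T2Space G] [MeasurableSpace G] [BorelSpace G]

/-- Left invariant vector fields are divergence free for a right invariant measure. -/
theorem integral_lieDeriv_eq_zero [SecondCountableTopology G] (μ : Measure G)
    [μ.IsMulRightInvariant] [IsFiniteMeasureOnCompacts μ]
    {f : G → ℝ} (hf : ContMDiff (𝓡 n) 𝓘(ℝ, ℝ) 1 f) (hfc : HasCompactSupport f)
    (v : GroupLieAlgebra (𝓡 n) G) :
    ∫ g, lieDeriv v f g ∂μ = 0 := by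
  have : IsTopologicalGroup G := topologicalGroup_of_lieGroup (𝓡 n) ∞
  have : IsManifold (𝓡 n) 1 G := IsManifold.of_le (n := ∞) (by norm_cast)
  -- Only the derivative at time zero matters, so a local integral curve is enough.
  obtain ⟨γ, h0, hγ⟩ := exists_isMIntegralCurveAt_of_contMDiffAt_boundaryless (I := 𝓡 n) 0
    ((contMDiff_mulInvariantVectorField_two v).of_le one_le_two).contMDiffAt (x₀ := (1 : G))
  obtain ⟨ε, hε, hγ⟩ := Metric.eventually_nhds_iff_ball.mp hγ
  have hsub : Metric.closedBall (0 : ℝ) (ε / 2) ⊆ Metric.ball 0 ε :=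
    Metric.closedBall_subset_ball (half_lt_self hε)
  have hγc : ContinuousOn γ (Metric.closedBall 0 (ε / 2)) := fun t ht =>
    (hγ t (hsub ht)).continuousAt.continuousWithinAt
  -- This compact set contains every `g` for which some `g * γ t` with `|t| ≤ ε / 2` meets the
  -- support, so it carries the dominating function.
  have hK : IsCompact (tsupport f * (γ '' Metric.closedBall 0 (ε / 2))⁻¹) :=
    hfc.isCompact.mul ((isCompact_closedBall _ _).image_of_continuousOn hγc).inv
  have hcd : Continuous (lieDeriv v f) :=
    (ContMDiff.lieDeriv (m := 0) (by simpa using hf) (by norm_num) v).continuous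
  obtain ⟨C, hC⟩ := (hfc.lieDeriv v).exists_bound_of_continuous hcd
  have hd := hasDerivAt_integral_of_dominated_loc_of_deriv_le (μ := μ) (x₀ := (0 : ℝ))
    (F := fun t g => f (g * γ t)) (F' := fun t g => lieDeriv v f (g * γ t))
    (bound := (tsupport f * (γ '' Metric.closedBall 0 (ε / 2))⁻¹).indicator fun _ => C)
    (s := Metric.closedBall 0 (ε / 2)) (Metric.closedBall_mem_nhds _ (half_pos hε))
    (Filter.Eventually.of_forall fun t =>
      (hf.continuous.comp (continuous_mul_const (γ t))).aestronglyMeasurable)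
    (by simpa [h0] using hf.continuous.integrable_of_hasCompactSupport hfc)
    (hcd.comp (continuous_mul_const (γ 0))).aestronglyMeasurable
    (Filter.Eventually.of_forall fun g t ht => by
      by_cases hg : g ∈ tsupport f * (γ '' Metric.closedBall 0 (ε / 2))⁻¹
      · rw [indicator_of_mem hg]
        exact hC _
      · have hz : lieDeriv v f (g * γ t) = 0 := image_eq_zero_of_notMem_tsupport fun h =>
          hg ⟨g * γ t, tsupport_lieDeriv_subset v f h, (γ t)⁻¹,
            Set.inv_mem_inv.mpr (mem_image_of_mem γ ht), by simp⟩
        rw [indicator_of_notMem hg, hz, norm_zero])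
    ((integrable_indicator_iff hK.measurableSet).mpr (integrableOn_const hK.measure_lt_top.ne))
    (Filter.Eventually.of_forall fun g t ht =>
      hasDerivAt_comp_mul_of_hasMFDerivAt (hγ t (hsub ht)) hf g)
  -- By right invariance `∫ f (g * γ t)` is constant in `t`, so its derivative vanishes.
  simp only [integral_mul_right_eq_self, h0, mul_one] at hd
  exact hd.2.unique (hasDerivAt_const _ _)

end Integration

end CourregeHunt

namespace CourregeHunt

/-! ### Pointwise and uniform bounds for compensated increments -/

section Estimates

/-- A weight dominating all compensated increments of test functions. -/
noncomputable def levyWeight {n : ℕ} {G : Type*} (U : Set G) (x : Fin n → G → ℝ) (τ : G) : ℝ :=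
  ∑ i, x i τ ^ 2 + Uᶜ.indicator 1 τ

variable {n : ℕ} {G : Type*} [TopologicalSpace G] [ChartedSpace (EuclideanSpace ℝ (Fin n)) G]
  [Group G]

theorem IsTestFunction.exists_bound {f : G → ℝ} (hf : IsTestFunction n f) :
    ∃ C, 0 ≤ C ∧ ∀ g, |f g| ≤ C := by
  obtain ⟨C, hC⟩ := hf.2.exists_bound_of_continuous hf.1.continuous
  exact ⟨C, (norm_nonneg _).trans (hC 1), hC⟩

/-- The compensated increment of `f` at `g`. -/
noncomputable def compIncr (X : Module.Basis (Fin n) ℝ (GroupLieAlgebra (𝓡 n) G)) (x : Fin n → G → ℝ)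
    (f : G → ℝ) (g τ : G) : ℝ :=
  f (g * τ) - f g - ∑ i, x i τ * lieDeriv (X i) f g

/-- The symmetric second difference of `f` at `g`. -/
def secondDiff (f : G → ℝ) (g τ : G) : ℝ := f (g * τ) - 2 * f g + f (g * τ⁻¹)

/-- The compensators cancel because the coordinates are odd. -/
theorem compIncr_add_compIncr_inv {X : Module.Basis (Fin n) ℝ (GroupLieAlgebra (𝓡 n) G)}
    {U : Set G} {x : Fin n → G → ℝ} (hx : IsCanonicalCoord X U x) (f : G → ℝ) (g τ : G) :
    compIncr X x f g τ + compIncr X x f g τ⁻¹ = secondDiff f g τ := by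
  simp only [compIncr, secondDiff, hx.odd, neg_mul, Finset.sum_neg_distrib]
  ring

section Smooth

variable [LieGroup (𝓡 n) ∞ G]

theorem IsTestFunction.contMDiff_lieDeriv {f : G → ℝ} (hf : IsTestFunction n f)
    (v : GroupLieAlgebra (𝓡 n) G) : ContMDiff (𝓡 n) 𝓘(ℝ, ℝ) 2 (lieDeriv v f) :=
  ContMDiff.lieDeriv (m := 2) (hf.1.of_le (by norm_cast)) le_rfl v

theorem IsTestFunction.contMDiff_lieDeriv_lieDeriv {f : G → ℝ} (hf : IsTestFunction n f)
    (v w : GroupLieAlgebra (𝓡 n) G) :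
    ContMDiff (𝓡 n) 𝓘(ℝ, ℝ) 1 (lieDeriv v (lieDeriv w f)) :=
  ContMDiff.lieDeriv (m := 1) ((hf.contMDiff_lieDeriv w).of_le (by norm_num)) (by norm_num) v

theorem IsTestFunction.exists_bound_lieDeriv {f : G → ℝ} (hf : IsTestFunction n f)
    (X : Fin n → GroupLieAlgebra (𝓡 n) G) :
    ∃ C, 0 ≤ C ∧ ∀ i g, |lieDeriv (X i) f g| ≤ C := by
  choose C hC using fun i => (hf.2.lieDeriv (X i)).exists_bound_of_continuous
    (hf.contMDiff_lieDeriv (X i)).continuous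
  have h0 : ∀ i, 0 ≤ C i := fun i => (norm_nonneg _).trans (hC i 1)
  exact ⟨∑ i, C i, Finset.sum_nonneg fun i _ => h0 i, fun i g => (hC i g).trans
    (Finset.single_le_sum (fun i _ => h0 i) (Finset.mem_univ i))⟩

theorem IsTestFunction.exists_bound_lieDeriv_lieDeriv {f : G → ℝ} (hf : IsTestFunction n f)
    (X : Fin n → GroupLieAlgebra (𝓡 n) G) :
    ∃ C, 0 ≤ C ∧ ∀ i j g, |lieDeriv (X i) (lieDeriv (X j) f) g| ≤ C := by
  choose C hC using fun i j => ((hf.2.lieDeriv (X j)).lieDeriv (X i)).exists_bound_of_continuous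
    (hf.contMDiff_lieDeriv_lieDeriv (X i) (X j)).continuous
  have h0 : ∀ i j, 0 ≤ C i j := fun i j => (norm_nonneg _).trans (hC i j 1)
  exact ⟨∑ i, ∑ j, C i j, Finset.sum_nonneg fun i _ => Finset.sum_nonneg fun j _ => h0 i j,
    fun i j g => (hC i j g).trans <|
      (Finset.single_le_sum (fun j _ => h0 i j) (Finset.mem_univ j)).trans <|
      Finset.single_le_sum (f := fun i => ∑ j, C i j)
        (fun i _ => Finset.sum_nonneg fun j _ => h0 i j) (Finset.mem_univ i)⟩

theorem lieDeriv_sum_smul_twice {f : G → ℝ} (hf : IsTestFunction n f)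
    (X : Fin n → GroupLieAlgebra (𝓡 n) G) (c : Fin n → ℝ) (g : G) :
    lieDeriv (∑ i, c i • X i) (lieDeriv (∑ i, c i • X i) f) g =
      ∑ i, ∑ j, c i * (c j * lieDeriv (X i) (lieDeriv (X j) f) g) := by
  have h1 : lieDeriv (∑ i, c i • X i) f = fun y => ∑ j, c j * lieDeriv (X j) f y :=
    funext fun y => lieDeriv_sum_smul _ _ _ _ _
  have hd : ∀ j, MDifferentiableAt (𝓡 n) 𝓘(ℝ, ℝ) (lieDeriv (X j) f) g := fun j =>
    (hf.contMDiff_lieDeriv (X j)).mdifferentiableAt two_ne_zero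
  have hc : ∀ j, MDifferentiableAt (𝓡 n) 𝓘(ℝ, ℝ) (fun _ : G => c j) g := fun j =>
    mdifferentiableAt_const
  rw [lieDeriv_sum_smul, h1]
  refine Finset.sum_congr rfl fun i _ => ?_
  rw [lieDeriv_sum (X i) Finset.univ (f := fun j y => c j * lieDeriv (X j) f y)
    fun j _ => (hc j).mul (hd j), Finset.mul_sum]
  refine Finset.sum_congr rfl fun j _ => ?_
  rw [lieDeriv_mul _ (hc j) (hd j), lieDeriv_const, zero_mul, zero_add]

/-- On `U` the Taylor estimate applies along `v = ∑ xᵢ Xᵢ`, and Cauchy–Schwarz bounds the second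
derivative along `v` by `n C₂ ∑ xᵢ²`. Off `U` the weight is at least one and the increment is
bounded. -/
theorem IsTestFunction.exists_abs_compIncr_le
    {X : Module.Basis (Fin n) ℝ (GroupLieAlgebra (𝓡 n) G)}
    {U : Set G} {x : Fin n → G → ℝ} (hx : IsCanonicalCoord X U x) {f : G → ℝ}
    (hf : IsTestFunction n f) :
    ∃ C, 0 ≤ C ∧ ∀ g τ, |compIncr X x f g τ| ≤ C * levyWeight U x τ := by
  obtain ⟨C₀, h₀, hC₀⟩ := hf.exists_bound
  obtain ⟨C₁, h₁, hC₁⟩ := hf.exists_bound_lieDeriv X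
  obtain ⟨C₂, h₂, hC₂⟩ := hf.exists_bound_lieDeriv_lieDeriv X
  choose D hD hxD using fun i => (hx.test i).exists_bound
  have hoff : 0 ≤ 2 * C₀ + ∑ i, D i * C₁ := by
    have := Finset.sum_nonneg (s := Finset.univ) fun i _ => mul_nonneg (hD i) h₁
    linarith
  have hon : 0 ≤ n * C₂ := by positivity
  refine ⟨n * C₂ + (2 * C₀ + ∑ i, D i * C₁), add_nonneg hon hoff, fun g τ => ?_⟩
  have hs : 0 ≤ ∑ i, x i τ ^ 2 := Finset.sum_nonneg fun _ _ => sq_nonneg _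
  by_cases hτ : τ ∈ U
  · have hw : levyWeight U x τ = ∑ i, x i τ ^ 2 := by simp [levyWeight, hτ]
    have key := (hx.exp_coord τ hτ).abs_sub_sub_lieDeriv_le (f := f) (hf.1.of_le (by norm_cast))
      (C := n * C₂ * ∑ i, x i τ ^ 2) (fun y => by
        rw [lieDeriv_sum_smul_twice hf]
        calc |∑ i, ∑ j, x i τ * (x j τ * lieDeriv (X i) (lieDeriv (X j) f) y)|
            ≤ ∑ i, ∑ j, |x i τ| * (|x j τ| * C₂) := by
              refine (Finset.abs_sum_le_sum_abs _ _).trans (Finset.sum_le_sum fun i _ => ?_)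
              refine (Finset.abs_sum_le_sum_abs _ _).trans (Finset.sum_le_sum fun j _ => ?_)
              rw [abs_mul, abs_mul]
              gcongr
              exact hC₂ i j y
          _ = (∑ i, |x i τ|) ^ 2 * C₂ := by
              simp_rw [← Finset.mul_sum, ← Finset.sum_mul]
              ring
          _ ≤ (n * ∑ i, |x i τ| ^ 2) * C₂ := by
              gcongr
              simpa using sq_sum_le_card_mul_sum_sq (s := Finset.univ) (f := fun i => |x i τ|)
          _ = n * C₂ * ∑ i, x i τ ^ 2 := by simp_rw [sq_abs]; ring) g
    rw [lieDeriv_sum_smul] at key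
    rw [hw, compIncr]
    exact key.trans (mul_le_mul_of_nonneg_right (le_add_of_nonneg_right hoff) hs)
  · have hw : 1 ≤ levyWeight U x τ := by simpa [levyWeight, hτ] using hs
    have h3 : |∑ i, x i τ * lieDeriv (X i) f g| ≤ ∑ i, D i * C₁ := by
      refine (Finset.abs_sum_le_sum_abs _ _).trans (Finset.sum_le_sum fun i _ => ?_)
      rw [abs_mul]
      exact mul_le_mul (hxD i τ) (hC₁ i g) (abs_nonneg _) (hD i)
    have h4 : |compIncr X x f g τ| ≤ 2 * C₀ + ∑ i, D i * C₁ := by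
      have a1 := abs_le.mp (hC₀ (g * τ))
      have a2 := abs_le.mp (hC₀ g)
      have a3 := abs_le.mp h3
      rw [compIncr, abs_le]
      constructor <;> linarith
    refine h4.trans ((le_add_of_nonneg_left hon).trans ?_)
    exact le_mul_of_one_le_right (add_nonneg hon hoff) hw

end Smooth

variable [MeasurableSpace G] [BorelSpace G]

/-- Each point other than the identity lies outside some member of a countable neighbourhood basis,
and off each member the mass is finite. This gives access to Fubini. -/
theorem IsLevyMeasure.sigmaFinite [T2Space G] [SecondCountableTopology G] {x : Fin n → G → ℝ}
    {ρ : Measure G} (hρ : IsLevyMeasure x ρ) : SigmaFinite ρ := by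
  obtain ⟨V, hV⟩ := (𝓝 (1 : G)).exists_antitone_basis
  refine ⟨⟨⟨fun k => (V k)ᶜ ∪ {1}, fun _ => trivial, fun k => ?_, ?_⟩⟩⟩
  · refine (measure_union_le _ _).trans_lt ?_
    rw [hρ.singleton_one, add_zero]
    exact hρ.finite_off _ (hV.1.mem_of_mem trivial)
  · refine eq_univ_of_forall fun y => mem_iUnion.mpr ?_
    rcases eq_or_ne y 1 with rfl | hy
    · exact ⟨0, Or.inr rfl⟩
    · obtain ⟨k, -, hk⟩ := hV.1.mem_iff.mp (isOpen_compl_singleton.mem_nhds hy.symm)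
      exact ⟨k, Or.inl fun h => hk h rfl⟩

theorem measurable_levyWeight {X : Module.Basis (Fin n) ℝ (GroupLieAlgebra (𝓡 n) G)}
    {U : Set G} {x : Fin n → G → ℝ} (hx : IsCanonicalCoord X U x) :
    Measurable (levyWeight U x) := by
  refine (Finset.measurable_sum _ fun i _ => ?_).add
    (measurable_one.indicator hx.isOpen.measurableSet.compl)
  exact (hx.test i).1.continuous.measurable.pow_const 2

variable {X : Module.Basis (Fin n) ℝ (GroupLieAlgebra (𝓡 n) G)}
  {U : Set G} {x : Fin n → G → ℝ} {b : Fin n → G → ℝ} {a : Fin n → Fin n → G → ℝ}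
  {ν : G → Measure G} {ρ : Measure G} {lam : G → G → ℝ}

theorem IsCharacteristics.lintegral_transl_eq (hchar : IsCharacteristics U x b a ν ρ lam) (g : G)
    {F : G → ℝ≥0∞} (hF : Measurable F) :
    ∫⁻ τ, F τ ∂(transl ν g) = ∫⁻ τ, ENNReal.ofReal (lam g τ) * F τ ∂ρ := by
  rw [hchar.density g, lintegral_withDensity_eq_lintegral_mul _ _ hF]
  · rfl
  · exact (hchar.lam_measurable.comp measurable_prodMk_left).ennreal_ofReal

theorem IsCharacteristics.integral_transl_eq (hchar : IsCharacteristics U x b a ν ρ lam) (g : G)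
    (F : G → ℝ) : ∫ τ, F τ ∂(transl ν g) = ∫ τ, lam g τ * F τ ∂ρ := by
  rw [hchar.density g, integral_withDensity_eq_integral_toReal_smul]
  · simp [ENNReal.toReal_ofReal (hchar.lam_nonneg g _)]
  · exact (hchar.lam_measurable.comp measurable_prodMk_left).ennreal_ofReal
  · simp

/-- Bounded coordinates make `∑ xᵢ²` comparable with its truncation at one, while the mass off `U`
is at most `M ρ(Uᶜ)`. Uniformity in `g` is what later bounds the operator. -/
theorem IsCharacteristics.lintegral_levyWeight_le (hx : IsCanonicalCoord X U x)
    (hchar : IsCharacteristics U x b a ν ρ lam) :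
    ∃ W : ℝ≥0∞, W < ⊤ ∧
      ∀ g, ∫⁻ τ, ENNReal.ofReal (levyWeight U x τ) ∂(transl ν g) ≤ W := by
  choose D hD hxD using fun i => (hx.test i).exists_bound
  obtain ⟨M, hM⟩ := hchar.lam_bdd_off
  set S : ℝ := 1 + ∑ i, D i ^ 2
  have hS1 : 1 ≤ S := le_add_of_nonneg_right (Finset.sum_nonneg fun _ _ => sq_nonneg _)
  have hS : ∀ τ, ∑ i, x i τ ^ 2 ≤ S * min (∑ i, x i τ ^ 2) 1 := by
    intro τ
    have hs : 0 ≤ ∑ i, x i τ ^ 2 := Finset.sum_nonneg fun _ _ => sq_nonneg _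
    rcases le_total (∑ i, x i τ ^ 2) 1 with h | h
    · rw [min_eq_left h]
      exact le_mul_of_one_le_left hs hS1
    · rw [min_eq_right h, mul_one]
      have : ∑ i, x i τ ^ 2 ≤ ∑ i, D i ^ 2 := Finset.sum_le_sum fun i _ =>
        sq_le_sq' (abs_le.mp (hxD i τ)).1 (abs_le.mp (hxD i τ)).2
      linarith
  have hUm : MeasurableSet Uᶜ := hx.isOpen.measurableSet.compl
  have hρU := hchar.ρ_levy.finite_off U (hx.isOpen.mem_nhds hx.one_mem)
  refine ⟨ENNReal.ofReal S *
    (⨆ g, ∫⁻ τ, ENNReal.ofReal (min (∑ i, x i τ ^ 2) 1) ∂(transl ν g)) +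
    ENNReal.ofReal M * ρ Uᶜ, ENNReal.add_lt_top.mpr
      ⟨ENNReal.mul_lt_top ENNReal.ofReal_lt_top hchar.ν_levy,
        ENNReal.mul_lt_top ENNReal.ofReal_lt_top hρU⟩, fun g => ?_⟩
  have hxm : Measurable fun τ => ∑ i, x i τ ^ 2 := Finset.measurable_sum _ fun i _ =>
    (hx.test i).1.continuous.measurable.pow_const 2
  calc ∫⁻ τ, ENNReal.ofReal (levyWeight U x τ) ∂(transl ν g)
      ≤ ∫⁻ τ, (ENNReal.ofReal S * ENNReal.ofReal (min (∑ i, x i τ ^ 2) 1)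
          + Uᶜ.indicator 1 τ) ∂(transl ν g) := by
        refine lintegral_mono fun τ => ?_
        rw [← ENNReal.ofReal_mul (zero_le_one.trans hS1)]
        refine ENNReal.ofReal_add_le.trans (add_le_add (ENNReal.ofReal_le_ofReal (hS τ)) ?_)
        by_cases h : τ ∈ U <;> simp [h]
    _ = ENNReal.ofReal S * ∫⁻ τ, ENNReal.ofReal (min (∑ i, x i τ ^ 2) 1) ∂(transl ν g)
          + transl ν g Uᶜ := by
        rw [lintegral_add_right _ (measurable_one.indicator hUm),
          lintegral_const_mul _ (hxm.min measurable_const).ennreal_ofReal,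
          lintegral_indicator_one hUm]
    _ ≤ _ := by
        gcongr
        · exact le_iSup (fun g => ∫⁻ τ, ENNReal.ofReal (min (∑ i, x i τ ^ 2) 1) ∂(transl ν g)) g
        · rw [hchar.density g, withDensity_apply _ hUm, ← setLIntegral_const]
          exact setLIntegral_mono measurable_const fun τ hτ =>
            ENNReal.ofReal_le_ofReal (hM τ hτ g)

end Estimates

end CourregeHunt

namespace CourregeHunt

/-! ### The operator in divergence and second difference form -/

section Integrals

variable {n : ℕ} {G : Type*} [TopologicalSpace G] [ChartedSpace (EuclideanSpace ℝ (Fin n)) G]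
  [Group G] [IsTopologicalGroup G] [LieGroup (𝓡 n) ∞ G] [SecondCountableTopology G]
  [MeasurableSpace G] [BorelSpace G]
  {X : Module.Basis (Fin n) ℝ (GroupLieAlgebra (𝓡 n) G)}
  {U : Set G} {x : Fin n → G → ℝ} {b : Fin n → G → ℝ} {a : Fin n → Fin n → G → ℝ}
  {ν : G → Measure G} {ρ : Measure G} {lam : G → G → ℝ}

theorem isInvInvariant_of_forall_apply_inv {m : Measure G}
    (h : ∀ A, MeasurableSet A → m A = m A⁻¹) : m.IsInvInvariant :=
  ⟨Measure.ext fun A hA => by rw [Measure.inv_apply, h A hA]⟩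

theorem map_mul_left_transl (ν : G → Measure G) (g : G) :
    (transl ν g).map (g * ·) = ν g := by
  rw [transl, Measure.map_map (measurable_const_mul g) (measurable_const_mul g⁻¹)]
  simp [Function.comp_def]

theorem integrable_iff_transl {F : G → ℝ} (g : G) :
    Integrable F (ν g) ↔ Integrable (fun τ => F (g * τ)) (transl ν g) := by
  conv_lhs => rw [← map_mul_left_transl ν g]
  exact (MeasurableEquiv.mulLeft g).measurableEmbedding.integrable_map_iff

theorem integral_eq_transl (F : G → ℝ) (g : G) :
    ∫ τ, F τ ∂(ν g) = ∫ τ, F (g * τ) ∂(transl ν g) := by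
  conv_lhs => rw [← map_mul_left_transl ν g]
  exact (MeasurableEquiv.mulLeft g).measurableEmbedding.integral_map _

theorem IsTestFunction.continuous_compIncr (hx : IsCanonicalCoord X U x) {f : G → ℝ}
    (hf : IsTestFunction n f) : Continuous (Function.uncurry (compIncr X x f)) := by
  have h1 := hf.1.continuous
  have h2 := fun i => (hf.contMDiff_lieDeriv (X i)).continuous
  have h3 := fun i => (hx.test i).1.continuous
  unfold compIncr Function.uncurry
  fun_prop

theorem continuous_secondDiff {f : G → ℝ} (hf : Continuous f) :
    Continuous (Function.uncurry (secondDiff f)) := by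
  unfold secondDiff Function.uncurry
  fun_prop

theorem IsCharacteristics.lintegral_compIncr_le (hx : IsCanonicalCoord X U x)
    (hchar : IsCharacteristics U x b a ν ρ lam) {f : G → ℝ} (hf : IsTestFunction n f) :
    ∃ W : ℝ≥0∞, W < ⊤ ∧ ∀ g, ∫⁻ τ, ‖compIncr X x f g τ‖ₑ ∂(transl ν g) ≤ W := by
  obtain ⟨C, hC0, hC⟩ := hf.exists_abs_compIncr_le hx
  obtain ⟨W, hW, hWg⟩ := hchar.lintegral_levyWeight_le hx
  refine ⟨ENNReal.ofReal C * W, ENNReal.mul_lt_top ENNReal.ofReal_lt_top hW, fun g => ?_⟩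
  calc ∫⁻ τ, ‖compIncr X x f g τ‖ₑ ∂(transl ν g)
      ≤ ∫⁻ τ, ENNReal.ofReal C * ENNReal.ofReal (levyWeight U x τ) ∂(transl ν g) := by
        refine lintegral_mono fun τ => ?_
        rw [← ENNReal.ofReal_mul hC0, Real.enorm_eq_ofReal_abs]
        exact ENNReal.ofReal_le_ofReal (hC g τ)
    _ ≤ _ := by
        rw [lintegral_const_mul _ (measurable_levyWeight hx).ennreal_ofReal]
        gcongr
        exact hWg g

/-- The second difference is the sum of the increments at `τ` and `τ⁻¹`, whose norms have the same
integral by inversion invariance. -/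
theorem IsCharacteristics.lintegral_secondDiff_le (hx : IsCanonicalCoord X U x)
    (hchar : IsCharacteristics U x b a ν ρ lam)
    (hsym : ∀ g A, MeasurableSet A → transl ν g A = transl ν g A⁻¹)
    {f : G → ℝ} (hf : IsTestFunction n f) :
    ∃ W : ℝ≥0∞, W < ⊤ ∧ ∀ g, ∫⁻ τ, ‖secondDiff f g τ‖ₑ ∂(transl ν g) ≤ W := by
  obtain ⟨W, hW, hWg⟩ := hchar.lintegral_compIncr_le hx hf
  refine ⟨W + W, ENNReal.add_lt_top.mpr ⟨hW, hW⟩, fun g => ?_⟩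
  have := isInvInvariant_of_forall_apply_inv (hsym g)
  have hm : Measurable fun τ => ‖compIncr X x f g τ‖ₑ :=
    ((hf.continuous_compIncr hx).measurable.comp measurable_prodMk_left).enorm
  calc ∫⁻ τ, ‖secondDiff f g τ‖ₑ ∂(transl ν g)
      ≤ ∫⁻ τ, (‖compIncr X x f g τ‖ₑ + ‖compIncr X x f g τ⁻¹‖ₑ) ∂(transl ν g) :=
        lintegral_mono fun τ => by
          rw [← compIncr_add_compIncr_inv hx]
          exact enorm_add_le _ _
    _ ≤ _ := by
        rw [lintegral_add_left hm,
          lintegral_inv_eq_self (fun τ => ‖compIncr X x f g τ‖ₑ) (μ := transl ν g)]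
        exact add_le_add (hWg g) (hWg g)

theorem IsCharacteristics.integrable_compIncr (hx : IsCanonicalCoord X U x)
    (hchar : IsCharacteristics U x b a ν ρ lam) {f : G → ℝ} (hf : IsTestFunction n f) (g : G) :
    Integrable (compIncr X x f g) (transl ν g) := by
  obtain ⟨W, hW, hWg⟩ := hchar.lintegral_compIncr_le hx hf
  exact ⟨((hf.continuous_compIncr hx).measurable.comp
    measurable_prodMk_left).aestronglyMeasurable, (hWg g).trans_lt hW⟩

theorem IsCharacteristics.integrable_secondDiff (hx : IsCanonicalCoord X U x)
    (hchar : IsCharacteristics U x b a ν ρ lam)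
    (hsym : ∀ g A, MeasurableSet A → transl ν g A = transl ν g A⁻¹)
    {f : G → ℝ} (hf : IsTestFunction n f) (g : G) :
    Integrable (secondDiff f g) (transl ν g) := by
  obtain ⟨W, hW, hWg⟩ := hchar.lintegral_secondDiff_le hx hsym hf
  exact ⟨((continuous_secondDiff hf.1.continuous).measurable.comp
    measurable_prodMk_left).aestronglyMeasurable, (hWg g).trans_lt hW⟩

theorem IsCharacteristics.integral_compIncr (hx : IsCanonicalCoord X U x)
    (hchar : IsCharacteristics U x b a ν ρ lam)
    (hsym : ∀ g A, MeasurableSet A → transl ν g A = transl ν g A⁻¹)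
    {f : G → ℝ} (hf : IsTestFunction n f) (g : G) :
    ∫ τ, compIncr X x f g τ ∂(transl ν g) = (1 / 2) * ∫ τ, secondDiff f g τ ∂(transl ν g) := by
  have := isInvInvariant_of_forall_apply_inv (hsym g)
  have hi := hchar.integrable_compIncr hx hf g
  simp_rw [← compIncr_add_compIncr_inv hx]
  rw [integral_add hi hi.comp_inv, integral_inv_eq_self (compIncr X x f g)]
  ring

/-- The second order differential part of the operator, in divergence form. -/
noncomputable def divPart (X : Module.Basis (Fin n) ℝ (GroupLieAlgebra (𝓡 n) G))
    (a : Fin n → Fin n → G → ℝ) (f : G → ℝ) (g : G) : ℝ :=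
  ∑ i, lieDeriv (X i) (fun g' => ∑ j, a i j g' * lieDeriv (X j) f g') g

/-- The Leibniz rule; symmetry of `a` matches `Xᵢ(aᵢⱼ)` with the divergence defining `bⱼ`. -/
theorem IsTestFunction.divPart_eq {f : G → ℝ} (hf : IsTestFunction n f)
    (ha : ∀ i j, ContMDiff (𝓡 n) 𝓘(ℝ, ℝ) 2 (a i j)) (hsymm : ∀ i j, a i j = a j i)
    (hb : ∀ g i, b i g = ∑ j, lieDeriv (X j) (a i j) g) (g : G) :
    divPart X a f g = ∑ i, b i g * lieDeriv (X i) f g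
      + ∑ i, ∑ j, a i j g * lieDeriv (X i) (lieDeriv (X j) f) g := by
  have hd : ∀ j, MDifferentiableAt (𝓡 n) 𝓘(ℝ, ℝ) (lieDeriv (X j) f) g := fun j =>
    (hf.contMDiff_lieDeriv (X j)).mdifferentiableAt two_ne_zero
  have hda : ∀ i j, MDifferentiableAt (𝓡 n) 𝓘(ℝ, ℝ) (a i j) g := fun i j =>
    (ha i j).mdifferentiableAt two_ne_zero
  have h1 : ∀ i, lieDeriv (X i) (fun g' => ∑ j, a i j g' * lieDeriv (X j) f g') g =
      ∑ j, lieDeriv (X i) (a i j) g * lieDeriv (X j) f g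
        + ∑ j, a i j g * lieDeriv (X i) (lieDeriv (X j) f) g := fun i => by
    rw [lieDeriv_sum (X i) Finset.univ (f := fun j y => a i j y * lieDeriv (X j) f y)
      fun j _ => (hda i j).mul (hd j), ← Finset.sum_add_distrib]
    exact Finset.sum_congr rfl fun j _ => lieDeriv_mul _ (hda i j) (hd j)
  rw [divPart, Finset.sum_congr rfl fun i _ => h1 i, Finset.sum_add_distrib, Finset.sum_comm]
  congr 1
  simp_rw [hb, Finset.sum_mul]
  refine Finset.sum_congr rfl fun i _ => Finset.sum_congr rfl fun j _ => ?_
  rw [hsymm]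

theorem IsCharacteristics.op_eq (hx : IsCanonicalCoord X U x)
    (hchar : IsCharacteristics U x b a ν ρ lam)
    (hsym : ∀ g A, MeasurableSet A → transl ν g A = transl ν g A⁻¹)
    (ha : ∀ i j, ContMDiff (𝓡 n) 𝓘(ℝ, ℝ) 2 (a i j))
    (hb : ∀ g i, b i g = ∑ j, lieDeriv (X j) (a i j) g)
    {f : G → ℝ} (hf : IsTestFunction n f) (g : G) :
    op X x b a ν f g = divPart X a f g + (1 / 2) * ∫ τ, secondDiff f g τ ∂(transl ν g) := by
  have hsymm : ∀ i j, a i j = a j i := fun i j => funext fun g => by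
    simpa using (hchar.a_posSemidef g).1.apply j i
  rw [op, hf.divPart_eq ha hsymm hb, ← hchar.integral_compIncr hx hsym hf g, integral_eq_transl]
  simp [compIncr]

variable [T2Space G]

/-- Each `Xᵢ(Fᵢ h)`, with `Fᵢ = ∑ⱼ aᵢⱼ Xⱼf`, integrates to zero. The resulting form is visibly
symmetric in `f` and `h` once `a` is. -/
theorem integral_divPart_mul (μ : Measure G) [μ.IsMulRightInvariant] [IsFiniteMeasureOnCompacts μ]
    (ha : ∀ i j, ContMDiff (𝓡 n) 𝓘(ℝ, ℝ) 2 (a i j))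
    {f h : G → ℝ} (hf : IsTestFunction n f) (hh : IsTestFunction n h) :
    ∫ g, divPart X a f g * h g ∂μ =
      -∑ i, ∑ j, ∫ g, a i j g * lieDeriv (X j) f g * lieDeriv (X i) h g ∂μ := by
  have hF : ∀ i, ContMDiff (𝓡 n) 𝓘(ℝ, ℝ) 1 fun g => ∑ j, a i j g * lieDeriv (X j) f g := fun i =>
    contMDiff_finsetSum fun j _ => ((ha i j).of_le one_le_two).mul
      ((hf.contMDiff_lieDeriv (X j)).of_le one_le_two)
  have hh1 : ContMDiff (𝓡 n) 𝓘(ℝ, ℝ) 1 h := hh.1.of_le (by norm_cast)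
  have hp : ∀ i g, lieDeriv (X i) (fun g => ∑ j, a i j g * lieDeriv (X j) f g) g * h g =
      lieDeriv (X i) (fun g => (∑ j, a i j g * lieDeriv (X j) f g) * h g) g
        - ∑ j, a i j g * lieDeriv (X j) f g * lieDeriv (X i) h g := fun i g => by
    rw [lieDeriv_mul _ ((hF i).mdifferentiableAt one_ne_zero)
      (hh1.mdifferentiableAt one_ne_zero), Finset.sum_mul]
    ring
  have hprod : ∀ i, ContMDiff (𝓡 n) 𝓘(ℝ, ℝ) 1
      fun g => (∑ j, a i j g * lieDeriv (X j) f g) * h g := fun i => (hF i).mul hh1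
  have hprodc : ∀ i, HasCompactSupport
      fun g => (∑ j, a i j g * lieDeriv (X j) f g) * h g := fun i => hh.2.mul_left
  have hint1 : ∀ i, Integrable (lieDeriv (X i)
      (fun g => (∑ j, a i j g * lieDeriv (X j) f g) * h g)) μ := fun i =>
    (ContMDiff.lieDeriv (m := 0) (by simpa using hprod i) (by norm_num)
      (X i)).continuous.integrable_of_hasCompactSupport ((hprodc i).lieDeriv (X i))
  have hint2 : ∀ i j, Integrable
      (fun g => a i j g * lieDeriv (X j) f g * lieDeriv (X i) h g) μ := fun i j =>
    (((ha i j).continuous.mul (hf.contMDiff_lieDeriv (X j)).continuous).mul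
      (hh.contMDiff_lieDeriv (X i)).continuous).integrable_of_hasCompactSupport
      (hh.2.lieDeriv (X i)).mul_left
  simp_rw [divPart, Finset.sum_mul, hp]
  have hint3 : ∀ i, Integrable
      (fun g => ∑ j, a i j g * lieDeriv (X j) f g * lieDeriv (X i) h g) μ := fun i =>
    integrable_finsetSum _ fun j _ => hint2 i j
  have hint4 : ∀ i, Integrable (fun g =>
      lieDeriv (X i) (fun g => (∑ j, a i j g * lieDeriv (X j) f g) * h g) g
        - ∑ j, a i j g * lieDeriv (X j) f g * lieDeriv (X i) h g) μ := fun i =>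
    (hint1 i).sub (hint3 i)
  rw [integral_finsetSum _ fun i _ => hint4 i, ← Finset.sum_neg_distrib]
  refine Finset.sum_congr rfl fun i _ => ?_
  rw [integral_sub (hint1 i) (hint3 i),
    integral_lieDeriv_eq_zero μ (hprod i) (hprodc i), zero_sub,
    integral_finsetSum _ fun j _ => hint2 i j]

theorem integral_divPart_mul_comm (μ : Measure G) [μ.IsMulRightInvariant]
    [IsFiniteMeasureOnCompacts μ] (ha : ∀ i j, ContMDiff (𝓡 n) 𝓘(ℝ, ℝ) 2 (a i j))
    (hsymm : ∀ i j, a i j = a j i)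
    {f h : G → ℝ} (hf : IsTestFunction n f) (hh : IsTestFunction n h) :
    ∫ g, divPart X a f g * h g ∂μ = ∫ g, f g * divPart X a h g ∂μ := by
  simp_rw [mul_comm (f _)]
  rw [integral_divPart_mul μ ha hf hh, integral_divPart_mul μ ha hh hf, Finset.sum_comm]
  congr 1
  refine Finset.sum_congr rfl fun i _ => Finset.sum_congr rfl fun j _ => ?_
  rw [hsymm]
  congr 1 with g
  ring

end Integrals

end CourregeHunt

namespace CourregeHunt

/-! ### Detailed balance, symmetry of the jump part, square integrability -/

section Symmetry

open scoped Pointwise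

variable {n : ℕ} {G : Type*} [TopologicalSpace G] [ChartedSpace (EuclideanSpace ℝ (Fin n)) G]
  [Group G] [IsTopologicalGroup G] [LieGroup (𝓡 n) ∞ G] [SecondCountableTopology G]
  [T2Space G] [LocallyCompactSpace G] [MeasurableSpace G] [BorelSpace G]
  {X : Module.Basis (Fin n) ℝ (GroupLieAlgebra (𝓡 n) G)}
  {U : Set G} {x : Fin n → G → ℝ} {b : Fin n → G → ℝ} {a : Fin n → Fin n → G → ℝ}
  {ν : G → Measure G} {ρ : Measure G} {lam : G → G → ℝ} {μ : Measure G}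

/-- On `U` the modulus condition applies; off `U` both values lie in `[0, M]`. -/
theorem IsCharacteristics.exists_bound_lam_sub (hx : IsCanonicalCoord X U x)
    (hchar : IsCharacteristics U x b a ν ρ lam) (hreg : IsRegular X μ U x b a ν ρ lam) :
    ∃ B, ∀ g τ, |lam (g * τ⁻¹) τ - lam g τ| ≤ B := by
  obtain ⟨M, hM⟩ := hchar.lam_bdd_off
  obtain ⟨K, hK, α, -, hαb, hα⟩ := hreg.lam_modulus
  choose D hD hxD using fun i => (hx.test i).exists_bound
  choose A hA using hαb
  refine ⟨max M (K * ∑ i, D i * A i), fun g τ => ?_⟩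
  by_cases hτ : τ ∈ U
  · refine le_max_of_le_right ((hα g ⟨τ, hτ⟩).trans ?_)
    gcongr
    refine (Finset.abs_sum_le_sum_abs _ _).trans (Finset.sum_le_sum fun i _ => ?_)
    rw [abs_mul]
    exact mul_le_mul (hxD i τ) (hA i _) (abs_nonneg _) (hD i)
  · refine le_max_of_le_left (abs_le.mpr ?_)
    have h1 := hM τ hτ (g * τ⁻¹)
    have h2 := hM τ hτ g
    have h3 := hchar.lam_nonneg (g * τ⁻¹) τ
    have h4 := hchar.lam_nonneg g τ
    constructor <;> linarith

/-- At `g * τ⁻¹` this function takes the value `f τ`, so `Rop` at `g` can be tested against an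
arbitrary function of the jump. -/
theorem IsTestFunction.comp_inv_mul {f : G → ℝ} (hf : IsTestFunction n f) (g : G) :
    IsTestFunction n fun y => f (y⁻¹ * g) :=
  ⟨hf.1.comp ((contMDiff_mul_right (I := 𝓡 n) (n := ∞) (a := g)).comp (contMDiff_inv (𝓡 n) ∞)),
    hf.2.comp_homeomorph ((Homeomorph.inv G).trans (Homeomorph.mulRight g))⟩

/-- Detailed balance: if `R_ρ` is a multiplication operator then it vanishes, and the density is
invariant under the right translation by the size of the jump. -/
theorem IsCharacteristics.ae_lam_mul_inv_eq (hx : IsCanonicalCoord X U x)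
    (hchar : IsCharacteristics U x b a ν ρ lam) (hreg : IsRegular X μ U x b a ν ρ lam)
    {c : G → ℝ} (hR : ∀ f, IsTestFunction n f → ∀ g, Rop ρ lam f g = c g * f g) (g : G) :
    ∀ᵐ τ ∂ρ, lam (g * τ⁻¹) τ = lam g τ := by
  obtain ⟨B, hB⟩ := hchar.exists_bound_lam_sub hx hreg
  have hm : Measurable fun τ => lam (g * τ⁻¹) τ - lam g τ :=
    (hchar.lam_measurable.comp ((measurable_inv.const_mul g).prodMk measurable_id)).sub
      (hchar.lam_measurable.comp measurable_prodMk_left)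
  -- The measure `ρ` may be infinite near the identity, but it is finite on open sets separated from
  -- it.
  have hloc : LocallyIntegrableOn (fun τ => lam (g * τ⁻¹) τ - lam g τ) {1}ᶜ ρ := by
    intro y hy
    obtain ⟨V, W, hV, hW, hyV, h1W, hVW⟩ := t2_separation (show y ≠ 1 from hy)
    refine ⟨V, mem_nhdsWithin_of_mem_nhds (hV.mem_nhds hyV), ?_⟩
    have hfin : ρ V < ⊤ := (measure_mono hVW.subset_compl_right).trans_lt
      (hchar.ρ_levy.finite_off W (hW.mem_nhds h1W))
    exact Measure.integrableOn_of_bounded hfin.ne hm.aestronglyMeasurable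
      (Filter.Eventually.of_forall fun τ => hB g τ)
  have h0 := isOpen_compl_singleton.ae_eq_zero_of_integral_contMDiff_smul_eq_zero (𝓡 n) hloc
    fun ψ hψ hψc hψs => by
      have h := hR _ (IsTestFunction.comp_inv_mul ⟨hψ, hψc⟩ g) g
      have hψ1 : ψ 1 = 0 := image_eq_zero_of_notMem_tsupport fun h => hψs h rfl
      simpa [Rop, hψ1] using h
  have h1 : ∀ᵐ τ ∂ρ, τ ∈ ({1}ᶜ : Set G) := by
    rw [ae_iff]
    simpa using hchar.ρ_levy.singleton_one
  filter_upwards [h0, h1] with τ h0 h1 using sub_eq_zero.mp (h0 h1)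

/-- For `τ` in `U` the bound is the attained supremum; it need not be uniform in `τ`, as it only
serves integrals in `g` at fixed `τ`. -/
theorem IsCharacteristics.exists_bound_lam (hchar : IsCharacteristics U x b a ν ρ lam) (τ : G) :
    ∃ B, ∀ g, |lam g τ| ≤ B := by
  simp_rw [abs_of_nonneg (hchar.lam_nonneg _ τ)]
  by_cases hτ : τ ∈ U
  · obtain ⟨g', hg'⟩ := hchar.lam_sup_attained
    exact ⟨_, hg' τ hτ⟩
  · obtain ⟨M, hM⟩ := hchar.lam_bdd_off
    exact ⟨M, hM τ hτ⟩

theorem integral_mul_secondDiff_comm [μ.IsMulRightInvariant] [IsFiniteMeasureOnCompacts μ]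
    {f h : G → ℝ} (hf : IsTestFunction n f) (hh : IsTestFunction n h) {l : G → ℝ}
    (hl : Measurable l) {B : ℝ} (hB : ∀ g, |l g| ≤ B) {τ : G}
    (hbal : ∀ᵐ g ∂μ, l (g * τ⁻¹) = l g) :
    ∫ g, h g * (l g * secondDiff f g τ) ∂μ = ∫ g, f g * (l g * secondDiff h g τ) ∂μ := by
  have hint : ∀ {u w : G → ℝ}, IsTestFunction n u → Continuous w →
      Integrable (fun g => u g * w g * l g) μ := fun hu hw =>
    ((hu.1.continuous.mul hw).integrable_of_hasCompactSupport hu.2.mul_right).mul_bdd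
      hl.aestronglyMeasurable (Filter.Eventually.of_forall hB)
  -- Substitute `g * τ⁻¹` for `g`; the balance leaves `l` unchanged, and the forward term becomes
  -- the backward term with `u` and `w` exchanged.
  have hswap : ∀ {u w : G → ℝ}, IsTestFunction n u → IsTestFunction n w →
      ∫ g, u g * w (g * τ) * l g ∂μ = ∫ g, w g * u (g * τ⁻¹) * l g ∂μ := fun {u w} hu hw => by
    rw [← integral_mul_right_eq_self _ τ⁻¹]
    refine integral_congr_ae ?_
    filter_upwards [hbal] with g hg
    rw [hg, inv_mul_cancel_right]
    ring
  have hexp : ∀ {u w : G → ℝ}, IsTestFunction n u → IsTestFunction n w →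
      ∫ g, u g * (l g * secondDiff w g τ) ∂μ = ∫ g, u g * w (g * τ) * l g ∂μ
        - 2 * ∫ g, u g * w g * l g ∂μ + ∫ g, u g * w (g * τ⁻¹) * l g ∂μ := fun {u w} hu hw => by
    have i1 : Integrable (fun g => u g * w (g * τ) * l g) μ :=
      hint hu (hw.1.continuous.comp (continuous_mul_const τ))
    have i2 := (hint hu hw.1.continuous).const_mul 2
    have i3 : Integrable (fun g => u g * w (g * τ⁻¹) * l g) μ :=
      hint hu (hw.1.continuous.comp (continuous_mul_const τ⁻¹))
    have i4 : Integrable (fun g => u g * w (g * τ) * l g - 2 * (u g * w g * l g)) μ := i1.sub i2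
    rw [← integral_const_mul, ← integral_sub i1 i2, ← integral_add i4 i3]
    congr 1 with g
    simp only [secondDiff]
    ring
  rw [hexp hh hf, hexp hf hh, hswap hh hf, hswap hf hh]
  simp_rw [mul_comm (h _) (f _)]
  ring

/-- The inner integral of `lam * secondDiff` is bounded uniformly in `g`, and `h` is integrable. -/
theorem IsCharacteristics.integrable_prod_mul_secondDiff [IsFiniteMeasureOnCompacts μ]
    (hx : IsCanonicalCoord X U x) (hchar : IsCharacteristics U x b a ν ρ lam)
    (hsym : ∀ g A, MeasurableSet A → transl ν g A = transl ν g A⁻¹)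
    {f h : G → ℝ} (hf : IsTestFunction n f) (hh : IsTestFunction n h) :
    Integrable (fun p : G × G => h p.1 * (lam p.1 p.2 * secondDiff f p.1 p.2)) (μ.prod ρ) := by
  have := hchar.ρ_levy.sigmaFinite
  obtain ⟨W, hW, hWg⟩ := hchar.lintegral_secondDiff_le hx hsym hf
  have hm : Measurable fun p : G × G => h p.1 * (lam p.1 p.2 * secondDiff f p.1 p.2) :=
    (hh.1.continuous.measurable.comp measurable_fst).mul
      (hchar.lam_measurable.mul (continuous_secondDiff hf.1.continuous).measurable)
  refine ⟨hm.aestronglyMeasurable, ?_⟩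
  have hint : Integrable h μ := hh.1.continuous.integrable_of_hasCompactSupport hh.2
  calc ∫⁻ p, ‖h p.1 * (lam p.1 p.2 * secondDiff f p.1 p.2)‖ₑ ∂(μ.prod ρ)
      = ∫⁻ g, ∫⁻ τ, ‖h g * (lam g τ * secondDiff f g τ)‖ₑ ∂ρ ∂μ :=
        lintegral_prod _ hm.enorm.aemeasurable
    _ ≤ ∫⁻ g, ‖h g‖ₑ * W ∂μ := by
        refine lintegral_mono fun g => ?_
        have hs : Measurable fun τ => ‖secondDiff f g τ‖ₑ :=
          ((continuous_secondDiff hf.1.continuous).measurable.comp measurable_prodMk_left).enorm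
        have hl : Measurable fun τ => ENNReal.ofReal (lam g τ) * ‖secondDiff f g τ‖ₑ :=
          (hchar.lam_measurable.comp measurable_prodMk_left).ennreal_ofReal.mul hs
        simp_rw [enorm_mul, Real.enorm_of_nonneg (hchar.lam_nonneg g _)]
        rw [lintegral_const_mul _ hl, ← hchar.lintegral_transl_eq g hs]
        gcongr
        exact hWg g
    _ < ⊤ := by
        rw [lintegral_mul_const _ hh.1.continuous.measurable.enorm]
        exact ENNReal.mul_lt_top hint.2 hW

theorem IsCharacteristics.integrable_mul_integral_secondDiff [IsFiniteMeasureOnCompacts μ]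
    (hx : IsCanonicalCoord X U x) (hchar : IsCharacteristics U x b a ν ρ lam)
    (hsym : ∀ g A, MeasurableSet A → transl ν g A = transl ν g A⁻¹)
    {f h : G → ℝ} (hf : IsTestFunction n f) (hh : IsTestFunction n h) :
    Integrable (fun g => h g * ∫ τ, secondDiff f g τ ∂(transl ν g)) μ := by
  have := hchar.ρ_levy.sigmaFinite
  have := (hchar.integrable_prod_mul_secondDiff (μ := μ) hx hsym hf hh).integral_prod_left
  simpa only [integral_const_mul, ← hchar.integral_transl_eq] using this

theorem IsCharacteristics.integral_mul_integral_secondDiff_comm [μ.IsMulRightInvariant]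
    [IsFiniteMeasureOnCompacts μ]
    (hx : IsCanonicalCoord X U x) (hchar : IsCharacteristics U x b a ν ρ lam)
    (hsym : ∀ g A, MeasurableSet A → transl ν g A = transl ν g A⁻¹)
    (hbal : ∀ g, ∀ᵐ τ ∂ρ, lam (g * τ⁻¹) τ = lam g τ)
    {f h : G → ℝ} (hf : IsTestFunction n f) (hh : IsTestFunction n h) :
    ∫ g, h g * ∫ τ, secondDiff f g τ ∂(transl ν g) ∂μ =
      ∫ g, f g * ∫ τ, secondDiff h g τ ∂(transl ν g) ∂μ := by
  have := hchar.ρ_levy.sigmaFinite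
  have hms : MeasurableSet {p : G × G | lam (p.1 * p.2⁻¹) p.2 = lam p.1 p.2} :=
    measurableSet_eq_fun
      (hchar.lam_measurable.comp
        ((measurable_fst.mul measurable_snd.inv).prodMk measurable_snd)) hchar.lam_measurable
  -- Balance holds for every `g` and almost every `τ`; at fixed `τ` it is needed for almost every
  -- `g`, so the quantifiers are exchanged.
  have hbal' : ∀ᵐ τ ∂ρ, ∀ᵐ g ∂μ, lam (g * τ⁻¹) τ = lam g τ :=
    (Measure.ae_ae_comm hms).mp (Filter.Eventually.of_forall hbal)
  have hfub : ∀ {u w : G → ℝ}, IsTestFunction n u → IsTestFunction n w →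
      ∫ g, u g * ∫ τ, secondDiff w g τ ∂(transl ν g) ∂μ =
        ∫ τ, ∫ g, u g * (lam g τ * secondDiff w g τ) ∂μ ∂ρ := fun {u w} hu hw => by
    rw [← integral_integral_swap (hchar.integrable_prod_mul_secondDiff hx hsym hw hu)]
    simp only [integral_const_mul, ← hchar.integral_transl_eq]
  rw [hfub hh hf, hfub hf hh]
  refine integral_congr_ae ?_
  filter_upwards [hbal'] with τ hτ
  obtain ⟨B, hB⟩ := hchar.exists_bound_lam τ
  exact integral_mul_secondDiff_comm hf hh (hchar.lam_measurable.comp measurable_prodMk_right) hB hτ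

theorem IsCharacteristics.measurable_op (hx : IsCanonicalCoord X U x)
    (hchar : IsCharacteristics U x b a ν ρ lam) {f : G → ℝ} (hf : IsTestFunction n f) :
    Measurable (op X x b a ν f) := by
  have := hchar.ρ_levy.sigmaFinite
  -- Rewriting against the fixed measure `ρ` makes this a parametrised integral of a jointly
  -- measurable function.
  have h1 : ∀ g, ∫ τ, (f τ - f g - ∑ i, x i (g⁻¹ * τ) * lieDeriv (X i) f g) ∂(ν g) =
      ∫ τ, lam g τ * compIncr X x f g τ ∂ρ := fun g => by
    rw [integral_eq_transl, ← hchar.integral_transl_eq]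
    simp [compIncr]
  have h2 : Measurable fun g => ∫ τ, lam g τ * compIncr X x f g τ ∂ρ :=
    (StronglyMeasurable.integral_prod_right (f := fun g τ => lam g τ * compIncr X x f g τ)
      (hchar.lam_measurable.mul
        (hf.continuous_compIncr hx).measurable).stronglyMeasurable).measurable
  unfold op
  simp_rw [h1]
  refine ((Finset.measurable_fun_sum _ fun i _ => ?_).add (Finset.measurable_fun_sum _ fun i _ =>
    Finset.measurable_fun_sum _ fun j _ => ?_)).add h2
  · exact (hchar.b_measurable i).mul (hf.contMDiff_lieDeriv (X i)).continuous.measurable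
  · exact (hchar.a_measurable i j).mul
      (hf.contMDiff_lieDeriv_lieDeriv (X i) (X j)).continuous.measurable

theorem IsCharacteristics.exists_bound_op (hx : IsCanonicalCoord X U x)
    (hchar : IsCharacteristics U x b a ν ρ lam) {f : G → ℝ} (hf : IsTestFunction n f) :
    ∃ C, 0 ≤ C ∧ ∀ g, |op X x b a ν f g| ≤ C := by
  obtain ⟨W, hW, hWg⟩ := hchar.lintegral_compIncr_le hx hf
  obtain ⟨C₁, h₁, hC₁⟩ := hf.exists_bound_lieDeriv X
  obtain ⟨C₂, h₂, hC₂⟩ := hf.exists_bound_lieDeriv_lieDeriv X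
  choose B hB using hchar.b_bdd
  choose A hA using hchar.a_bdd
  have key : ∀ g, |op X x b a ν f g| ≤
      ∑ i, B i * C₁ + ∑ i, ∑ j, A i j * C₂ + W.toReal := fun g => by
    refine (abs_add_le _ _).trans (add_le_add ((abs_add_le _ _).trans (add_le_add ?_ ?_)) ?_)
    · refine (Finset.abs_sum_le_sum_abs _ _).trans (Finset.sum_le_sum fun i _ => ?_)
      rw [abs_mul]
      exact mul_le_mul (hB i g) (hC₁ i g) (abs_nonneg _) ((abs_nonneg _).trans (hB i g))
    · refine (Finset.abs_sum_le_sum_abs _ _).trans (Finset.sum_le_sum fun i _ => ?_)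
      refine (Finset.abs_sum_le_sum_abs _ _).trans (Finset.sum_le_sum fun j _ => ?_)
      rw [abs_mul]
      exact mul_le_mul (hA i j g) (hC₂ i j g) (abs_nonneg _) ((abs_nonneg _).trans (hA i j g))
    · rw [integral_eq_transl]
      simp only [inv_mul_cancel_left]
      have h := enorm_integral_le_lintegral_enorm (μ := transl ν g) (compIncr X x f g)
      have h' := ENNReal.toReal_mono hW.ne (h.trans (hWg g))
      rwa [toReal_enorm] at h'
  exact ⟨_, (abs_nonneg _).trans (key 1), key⟩

/-- For such `g`, `f` and its derivatives vanish at `g`, and no jump in `U` reaches the support.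
Only jumps outside `U` remain, where the density is at most `M`. -/
theorem IsCharacteristics.abs_op_le_of_notMem (hx : IsCanonicalCoord X U x)
    (hchar : IsCharacteristics U x b a ν ρ lam) {M : ℝ} (hM : ∀ τ ∉ U, ∀ g, lam g τ ≤ M)
    {f : G → ℝ} (hf : IsTestFunction n f) {g : G} (hg : g ∉ tsupport f * (closure U)⁻¹) :
    |op X x b a ν f g| ≤ M * ∫ τ in Uᶜ, |f (g * τ)| ∂ρ := by
  have hU : ∀ τ ∈ U, f (g * τ) = 0 := fun τ hτ => image_eq_zero_of_notMem_tsupport fun h =>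
    hg ⟨g * τ, h, τ⁻¹, Set.inv_mem_inv.mpr (subset_closure hτ), by simp⟩
  have hgs : g ∉ tsupport f := fun h => hg ⟨g, h, 1,
    by simpa using subset_closure hx.one_mem, mul_one g⟩
  have hf0 : f g = 0 := image_eq_zero_of_notMem_tsupport hgs
  have hf1 : ∀ i, lieDeriv (X i) f g = 0 := fun i =>
    image_eq_zero_of_notMem_tsupport fun h => hgs (tsupport_lieDeriv_subset _ _ h)
  have hf2 : ∀ i j, lieDeriv (X i) (lieDeriv (X j) f) g = 0 := fun i j =>
    image_eq_zero_of_notMem_tsupport fun h =>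
      hgs (tsupport_lieDeriv_subset _ _ (tsupport_lieDeriv_subset _ _ h))
  have hop : op X x b a ν f g = ∫ τ, lam g τ * f (g * τ) ∂ρ := by
    simp [op, hf0, hf1, hf2, integral_eq_transl, hchar.integral_transl_eq]
  have hset : ∫ τ, lam g τ * f (g * τ) ∂ρ = ∫ τ in Uᶜ, lam g τ * f (g * τ) ∂ρ :=
    (setIntegral_eq_integral_of_forall_compl_eq_zero fun τ hτ => by
      rw [hU τ (not_not.mp hτ), mul_zero]).symm
  have hρU := hchar.ρ_levy.finite_off U (hx.isOpen.mem_nhds hx.one_mem)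
  obtain ⟨C, -, hC⟩ := hf.exists_bound
  have hint : IntegrableOn (fun τ => |f (g * τ)|) Uᶜ ρ :=
    Measure.integrableOn_of_bounded hρU.ne
      (hf.1.continuous.comp (continuous_const_mul g)).abs.aestronglyMeasurable
      (Filter.Eventually.of_forall fun τ => by simpa using hC (g * τ))
  rw [hop, hset, ← integral_const_mul]
  change ‖∫ τ in Uᶜ, lam g τ * f (g * τ) ∂ρ‖ ≤ _
  refine norm_integral_le_of_norm_le (hint.const_mul M) ?_
  filter_upwards [ae_restrict_mem hx.isOpen.measurableSet.compl] with τ hτ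
  rw [Real.norm_eq_abs, abs_mul, abs_of_nonneg (hchar.lam_nonneg g τ)]
  exact mul_le_mul_of_nonneg_right (hM τ hτ g) (abs_nonneg _)

/-- By right invariance all translates of `|f|` have the same integral, and `m` is finite. -/
theorem integrable_integral_comp_mul [μ.IsMulRightInvariant] [IsFiniteMeasureOnCompacts μ]
    (m : Measure G) [IsFiniteMeasure m] {f : G → ℝ} (hf : Continuous f)
    (hfc : HasCompactSupport f) :
    Integrable (fun g => ∫ τ, |f (g * τ)| ∂m) μ := by
  have hi : Integrable (fun g => |f g|) μ := (hf.integrable_of_hasCompactSupport hfc).abs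
  have hp : Integrable (fun p : G × G => |f (p.1 * p.2)|) (μ.prod m) := by
    have hm : AEStronglyMeasurable (fun p : G × G => |f (p.1 * p.2)|) (μ.prod m) :=
      (hf.comp continuous_mul).abs.aestronglyMeasurable
    rw [integrable_prod_iff' hm]
    refine ⟨Filter.Eventually.of_forall fun τ => hi.comp_mul_right τ, ?_⟩
    simp only [Real.norm_eq_abs, abs_abs, integral_mul_right_eq_self (fun g => |f g|)]
    exact integrable_const _
  exact hp.integral_prod_left

theorem IsCharacteristics.memLp_op [μ.IsMulRightInvariant] [IsFiniteMeasureOnCompacts μ]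
    (hx : IsCanonicalCoord X U x)
    (hchar : IsCharacteristics U x b a ν ρ lam) {f : G → ℝ} (hf : IsTestFunction n f) :
    MemLp (op X x b a ν f) 2 μ := by
  have hm := hchar.measurable_op hx hf
  obtain ⟨C, hC0, hC⟩ := hchar.exists_bound_op hx hf
  obtain ⟨M, hM⟩ := hchar.lam_bdd_off
  have hK : IsCompact (tsupport f * (closure U)⁻¹) :=
    hf.2.isCompact.mul hx.isCompact_closure.inv
  have : IsFiniteMeasure (ρ.restrict Uᶜ) := ⟨by
    simpa using hchar.ρ_levy.finite_off U (hx.isOpen.mem_nhds hx.one_mem)⟩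
  -- `|M|` replaces `M`, which could be negative when `U` is all of `G`; both summands must be
  -- nonnegative.
  have hbound : Integrable (fun g => (tsupport f * (closure U)⁻¹).indicator (fun _ => C) g
      + |M| * ∫ τ in Uᶜ, |f (g * τ)| ∂ρ) μ :=
    ((integrable_indicator_iff hK.measurableSet).mpr
      (integrableOn_const hK.measure_lt_top.ne)).add
      ((integrable_integral_comp_mul _ hf.1.continuous hf.2).const_mul _)
  have hint : Integrable (op X x b a ν f) μ := by
    refine hbound.mono' hm.aestronglyMeasurable (Filter.Eventually.of_forall fun g => ?_)
    have hQ : 0 ≤ ∫ τ in Uᶜ, |f (g * τ)| ∂ρ := integral_nonneg fun _ => abs_nonneg _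
    by_cases hg : g ∈ tsupport f * (closure U)⁻¹
    · rw [indicator_of_mem hg]
      exact (hC g).trans (le_add_of_nonneg_right (mul_nonneg (abs_nonneg _) hQ))
    · rw [indicator_of_notMem hg, zero_add]
      exact (hchar.abs_op_le_of_notMem hx hM hf hg).trans
        (mul_le_mul_of_nonneg_right (le_abs_self M) hQ)
  -- The square is an integrable function times a bounded one.
  rw [memLp_two_iff_integrable_sq hm.aestronglyMeasurable]
  simp_rw [sq]
  exact hint.mul_bdd hm.aestronglyMeasurable (Filter.Eventually.of_forall hC)

theorem integrable_divPart_mul [IsFiniteMeasureOnCompacts μ]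
    (ha : ∀ i j, ContMDiff (𝓡 n) 𝓘(ℝ, ℝ) 2 (a i j))
    {f h : G → ℝ} (hf : IsTestFunction n f) (hh : IsTestFunction n h) :
    Integrable (fun g => divPart X a f g * h g) μ := by
  have hF : ∀ i, ContMDiff (𝓡 n) 𝓘(ℝ, ℝ) 1 fun g => ∑ j, a i j g * lieDeriv (X j) f g := fun i =>
    contMDiff_finsetSum fun j _ => ((ha i j).of_le one_le_two).mul
      ((hf.contMDiff_lieDeriv (X j)).of_le one_le_two)
  refine ((continuous_finsetSum _ fun i _ => ?_).mul
    hh.1.continuous).integrable_of_hasCompactSupport hh.2.mul_left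
  exact (ContMDiff.lieDeriv (m := 0) (by simpa using hF i) (by norm_num) (X i)).continuous

theorem IsCharacteristics.isSymmetricOp [μ.IsMulRightInvariant] [IsFiniteMeasureOnCompacts μ]
    (hx : IsCanonicalCoord X U x) (hchar : IsCharacteristics U x b a ν ρ lam)
    (hsym : ∀ g A, MeasurableSet A → transl ν g A = transl ν g A⁻¹)
    (ha : ∀ i j, ContMDiff (𝓡 n) 𝓘(ℝ, ℝ) 2 (a i j))
    (hb : ∀ g i, b i g = ∑ j, lieDeriv (X j) (a i j) g)
    (hbal : ∀ g, ∀ᵐ τ ∂ρ, lam (g * τ⁻¹) τ = lam g τ) :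
    IsSymmetricOp n μ (op X x b a ν) := by
  have hsymm : ∀ i j, a i j = a j i := fun i j => funext fun g => by
    simpa using (hchar.a_posSemidef g).1.apply j i
  refine ⟨fun f hf => hchar.memLp_op hx hf, fun f h hf hh => ?_⟩
  have hsplit : ∀ {u w : G → ℝ}, IsTestFunction n u → IsTestFunction n w →
      ∫ g, op X x b a ν u g * w g ∂μ = ∫ g, divPart X a u g * w g ∂μ
        + (1 / 2) * ∫ g, w g * ∫ τ, secondDiff u g τ ∂(transl ν g) ∂μ := fun {u w} hu hw => by
    rw [← integral_const_mul, ← integral_add (integrable_divPart_mul ha hu hw)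
      ((hchar.integrable_mul_integral_secondDiff hx hsym hu hw).const_mul _)]
    congr 1 with g
    rw [hchar.op_eq hx hsym ha hb hu]
    ring
  simp_rw [mul_comm (f _)]
  rw [hsplit hf hh, hsplit hh hf, integral_divPart_mul_comm μ ha hsymm hf hh,
    hchar.integral_mul_integral_secondDiff_comm hx hsym hbal hf hh]
  simp_rw [mul_comm (f _) (divPart _ _ _ _)]

end Symmetry

end CourregeHunt

theorem mainTheorem8 {n : ℕ} {G : Type*} [TopologicalSpace G] [T2Space G]
    [SecondCountableTopology G] [ChartedSpace (EuclideanSpace ℝ (Fin n)) G] [Group G]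
    [LieGroup (𝓡 n) ∞ G] [MeasurableSpace G] [BorelSpace G]
    (μ : Measure G) [μ.IsMulRightInvariant] [IsFiniteMeasureOnCompacts μ] [μ.IsOpenPosMeasure]
    (X : Module.Basis (Fin n) ℝ (GroupLieAlgebra (𝓡 n) G))
    (U : Set G) (x : Fin n → G → ℝ) (hx : CourregeHunt.IsCanonicalCoord X U x)
    (b : Fin n → G → ℝ) (a : Fin n → Fin n → G → ℝ) (ν : G → Measure G)
    (ρ : Measure G) (lam : G → G → ℝ)
    (hchar : CourregeHunt.IsCharacteristics U x b a ν ρ lam)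
    (hreg : CourregeHunt.IsRegular X μ U x b a ν ρ lam)
    (h1 : ∀ g i, b i g = ∑ j, CourregeHunt.lieDeriv (X j) (a i j) g)
    (h2 : ∀ f, CourregeHunt.IsTestFunction n f →
      ∀ g, CourregeHunt.Rop ρ lam f g = -CourregeHunt.cFun X x ρ lam g * f g)
    (h3 : ∀ g A, MeasurableSet A →
      CourregeHunt.transl ν g A = CourregeHunt.transl ν g A⁻¹) :
    CourregeHunt.IsSymmetricOp n μ (CourregeHunt.op X x b a ν) ∧
    ∀ f, CourregeHunt.IsTestFunction n f → ∀ g,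
      Integrable (fun τ => f τ - f g - ∑ i, x i (g⁻¹ * τ) * CourregeHunt.lieDeriv (X i) f g)
        (ν g) ∧
      Integrable (fun τ => f (g * τ) - 2 * f g + f (g * τ⁻¹)) (CourregeHunt.transl ν g) ∧
      CourregeHunt.op X x b a ν f g =
        ∑ i, CourregeHunt.lieDeriv (X i)
          (fun g' => ∑ j, a i j g' * CourregeHunt.lieDeriv (X j) f g') g
        + (1 / 2) * ∫ τ, (f (g * τ) - 2 * f g + f (g * τ⁻¹)) ∂(CourregeHunt.transl ν g) := by
  have : IsTopologicalGroup G := topologicalGroup_of_lieGroup (𝓡 n) ∞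
  have : LocallyCompactSpace G := ChartedSpace.locallyCompactSpace (EuclideanSpace ℝ (Fin n)) G
  have hbal := fun g => hchar.ae_lam_mul_inv_eq hx hreg h2 g
  refine ⟨hchar.isSymmetricOp hx h3 hreg.a_contMDiff h1 hbal, fun f hf g => ⟨?_,
    hchar.integrable_secondDiff hx h3 hf g, hchar.op_eq hx h3 hreg.a_contMDiff h1 hf g⟩⟩
  rw [CourregeHunt.integrable_iff_transl]
  simp only [inv_mul_cancel_left]
  exact hchar.integrable_compIncr hx hf g
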